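/- Let $m\ge 2$ be an integer, $\beta=1/m$ and $\mu>0$. Let $f(x,t)$, $x,t>0$, be the density (continuous in $x$) of the $\beta$-stable subordinator, i.e. $\int_0^\infty e^{-sx}f(x,t)\,dx=e^{-ts^{\beta}}$ for all $s\ge 0$, $t>0$. A tempered stable subordinator $D_\mu$ of index $\beta$ and tempering parameter $\mu$ is a subordinator (a process started at $0$ with independent and stationary increments and almost surely nondecreasing right-continuous paths) such that, for each $t>0$, $D_\mu(t)$ has density $$f_\mu(x,t)=e^{-\mu x+\mu^{\beta}t}f(x,t),\qquad x>0.$$ Then the density $f_\mu(x,t)$ (in its version continuous in $x$) has, at all $x,t>0$, continuous partial derivatives in $t$ up to order $m$ (continuous as functions of $t$) and a partial derivative in $x$, and satisfies $$\sum_{j=1}^{m}(-1)^j\binom{m}{j}\mu^{1-j/m}\,\frac{\partial^j}{\partial t^j}f_\mu(x,t)=\frac{\partial}{\partial x}f_\mu(x,t),\qquad x,t>0.$$ -/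

import Mathlib

open MeasureTheory ProbabilityTheory Set
open scoped NNReal

/-- A (real-valued) subordinator: a process started at `0` with independent and stationary
increments whose sample paths are almost surely nondecreasing and right-continuous. -/
structure IsSubordinator {Ω : Type*} [MeasurableSpace Ω] (P : Measure Ω) (D : ℝ≥0 → Ω → ℝ) :
    Prop where
  aemeasurable : ∀ t, AEMeasurable (D t) P
  zero : ∀ᵐ ω ∂P, D 0 ω = 0
  indep : HasIndepIncrements D P
  stationary : ∀ s t, IdentDistrib (fun ω => D (s + t) ω - D s ω) (D t) P P
  monotone : ∀ᵐ ω ∂P, Monotone fun t => D t ω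
  rightCts : ∀ᵐ ω ∂P, ∀ t, ContinuousWithinAt (fun u => D u ω) (Ici t) t

/-- `g` is the (continuous) density `g (x, t)`, `x, t > 0`, of the process `D`: for every `t > 0`
the law of `D t` is `g (x, t) dx` on `(0, ∞)`. Continuity in `x` selects the usual version of
the density. The values of `g` outside `x, t > 0` are irrelevant. -/
structure IsDensityOf {Ω : Type*} [MeasurableSpace Ω] (P : Measure Ω) (D : ℝ≥0 → Ω → ℝ)
    (g : ℝ → ℝ → ℝ) : Prop where
  nonneg : ∀ t : ℝ≥0, 0 < t → ∀ x : ℝ, 0 < x → 0 ≤ g x t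
  continuousOn : ∀ t : ℝ≥0, 0 < t → ContinuousOn (fun x => g x t) (Ioi 0)
  law : ∀ t : ℝ≥0, 0 < t →
    P.map (D t) = (volume.restrict (Ioi (0 : ℝ))).withDensity fun x => ENNReal.ofReal (g x t)

/-- `f` is the (continuous) density `f (x, t)`, `x, t > 0`, of the stable subordinator of index
`β`, that is, `∫₀^∞ e^{-s x} f (x, t) dx = e^{-t s ^ β}`. The case `s = 0` says that
`f (·, t)` is a probability density. -/
structure IsStableDensity (β : ℝ) (f : ℝ → ℝ → ℝ) : Prop where
  nonneg : ∀ t : ℝ, 0 < t → ∀ x : ℝ, 0 < x → 0 ≤ f x t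
  continuousOn : ∀ t : ℝ, 0 < t → ContinuousOn (fun x => f x t) (Ioi 0)
  laplace : ∀ t : ℝ, 0 < t → ∀ s : ℝ, 0 ≤ s →
    ∫ x in Ioi (0 : ℝ), Real.exp (-s * x) * f x t = Real.exp (-t * s ^ β)

/-- The exponential tempering `e^{-μ x + μ ^ β t} f (x, t)` of a density `f`. -/
noncomputable def temperedDensity (β μ : ℝ) (f : ℝ → ℝ → ℝ) (x t : ℝ) : ℝ :=
  Real.exp (-μ * x + μ ^ β * t) * f x t

/-- A tempered stable subordinator with index `β` and tempering parameter `μ`: a subordinator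
whose density is the exponential tempering of the `β`-stable density. -/
structure IsTemperedStableSubordinator {Ω : Type*} [MeasurableSpace Ω] (P : Measure Ω)
    (β μ : ℝ) (D : ℝ≥0 → Ω → ℝ) : Prop where
  isSubordinator : IsSubordinator P D
  density : ∃ f : ℝ → ℝ → ℝ, IsStableDensity β f ∧ IsDensityOf P D (temperedDensity β μ f)

open FourierTransform

/-! ### Characteristic function of the tempered law -/

section Transform

variable {Ω : Type*} [MeasurableSpace Ω] {P : Measure Ω} {D : ℝ≥0 → Ω → ℝ}

/-! On the Fourier side the density at time `t` becomes `exp (t ψ(v))` with `ψ(v) = μ ^ β - (μ +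
2πiv) ^ β`. By inversion it is the integral of `exp (2πivx + t ψ(v))` over `v`, so `∂/∂t` multiplies
the integrand by `ψ` and `∂/∂x` by `2πiv`. The equation is then the binomial expansion of `(μ ^
(1/m) - ψ) ^ m = μ + 2πiv`, with the `j = 0` term cancelling `μ`.

Two analytic points carry this. The Laplace transform is given only at real arguments and reaches
the imaginary axis by analytic continuation (`complexMGF_eq`). Differentiation under the integral
rests on the decay of `exp (t ψ)`: as `β ≤ 1/2`, the real part of `(μ + 2πiv) ^ β` dominates a fixed
multiple of its modulus (`le_re_lineCpow`). -/

theorem IsDensityOf.integral_map {g : ℝ → ℝ → ℝ} (hg : IsDensityOf P D g) {t : ℝ≥0} (ht : 0 < t)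
    {E : Type*} [NormedAddCommGroup E] [NormedSpace ℝ E] (h : ℝ → E) :
    ∫ x, h x ∂(P.map (D t)) = ∫ x in Ioi (0 : ℝ), g x t • h x := by
  have hmeas : AEMeasurable (fun x => ENNReal.ofReal (g x t)) (volume.restrict (Ioi (0 : ℝ))) :=
    ((hg.continuousOn t ht).aemeasurable measurableSet_Ioi).ennreal_ofReal
  rw [hg.law t ht, integral_withDensity_eq_integral_toReal_smul₀ hmeas (by simp)]
  refine setIntegral_congr_fun measurableSet_Ioi fun x hx => ?_
  simp only [ENNReal.toReal_ofReal (hg.nonneg t ht x hx)]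

/-- Tempering shifts the Laplace variable to `s = μ - u`. -/
theorem IsTemperedStableSubordinator.mgf_eq {β μ : ℝ}
    (hD : IsTemperedStableSubordinator P β μ D) {t : ℝ≥0} (ht : 0 < t) {u : ℝ} (hu : u ≤ μ) :
    mgf id (P.map (D t)) u = Real.exp (t * (μ ^ β - (μ - u) ^ β)) := by
  obtain ⟨f, hf, hg⟩ := hD.density
  rw [mgf, hg.integral_map ht]
  have h := hf.laplace t ht (μ - u) (sub_nonneg.2 hu)
  rw [mul_sub, sub_eq_add_neg, Real.exp_add, ← neg_mul, ← h, ← integral_const_mul]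
  refine integral_congr_ae (Filter.Eventually.of_forall fun x => ?_)
  simp only [temperedDensity, smul_eq_mul, id]
  rw [show Real.exp (-μ * x + μ ^ β * t) * f x t * Real.exp (u * x) =
    (Real.exp (-μ * x + μ ^ β * t) * Real.exp (u * x)) * f x t by ring, ← mul_assoc,
    ← Real.exp_add, ← Real.exp_add]
  ring_nf

theorem IsTemperedStableSubordinator.Iio_subset_integrableExpSet {β μ : ℝ}
    (hD : IsTemperedStableSubordinator P β μ D) {t : ℝ≥0} (ht : 0 < t) :
    Iio μ ⊆ interior (integrableExpSet id (P.map (D t))) := by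
  refine interior_maximal (fun u hu => ?_) isOpen_Iio
  -- A divergent integral would give the `mgf` its default value `0`, but its value is an
  -- exponential.
  by_contra h
  have h0 := mgf_undef (X := id) (μ := P.map (D t)) (t := u) h
  rw [hD.mgf_eq ht (le_of_lt hu)] at h0
  exact (Real.exp_pos _).ne' h0

/-- Identity theorem: both sides are analytic on the half-plane `re z < μ` and agree at its real
points, which accumulate at `μ - 1`. -/
theorem IsTemperedStableSubordinator.complexMGF_eq {β μ : ℝ} (hμ : 0 < μ)
    (hD : IsTemperedStableSubordinator P β μ D) {t : ℝ≥0} (ht : 0 < t) {z : ℂ} (hz : z.re < μ) :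
    complexMGF id (P.map (D t)) z =
      Complex.exp (t * ((μ : ℂ) ^ (β : ℂ) - ((μ : ℂ) - z) ^ (β : ℂ))) := by
  have hopen : IsOpen {z : ℂ | z.re < μ} := isOpen_Iio.preimage Complex.continuous_re
  have h1 : AnalyticOnNhd ℂ (complexMGF id (P.map (D t))) {z : ℂ | z.re < μ} := fun w hw =>
    analyticAt_complexMGF (hD.Iio_subset_integrableExpSet ht hw)
  have h2 : AnalyticOnNhd ℂ
      (fun z => Complex.exp (t * ((μ : ℂ) ^ (β : ℂ) - ((μ : ℂ) - z) ^ (β : ℂ))))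
      {z : ℂ | z.re < μ} := by
    refine DifferentiableOn.analyticOnNhd (fun w hw => ?_) hopen
    have : (μ : ℂ) - w ∈ Complex.slitPlane := Or.inl (by simpa using hw)
    refine DifferentiableAt.differentiableWithinAt ?_
    refine (((differentiableAt_const _).sub ?_).const_mul _).cexp
    exact ((differentiableAt_const _).sub differentiableAt_id).cpow_const this
  have hconv : Convex ℝ {z : ℂ | z.re < μ} := convex_halfSpace_re_lt μ
  refine h1.eqOn_of_preconnected_of_frequently_eq h2 hconv.isPreconnected
    (z₀ := ((μ - 1 : ℝ) : ℂ)) (by simp) ?_ hz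
  have hreal : ∀ u : ℝ, u < μ → complexMGF id (P.map (D t)) u =
      Complex.exp (t * ((μ : ℂ) ^ (β : ℂ) - ((μ : ℂ) - u) ^ (β : ℂ))) := by
    intro u hu
    rw [complexMGF_ofReal, hD.mgf_eq ht hu.le, Complex.ofReal_exp, Complex.ofReal_mul,
      Complex.ofReal_sub, Complex.ofReal_cpow hμ.le, Complex.ofReal_cpow (sub_nonneg.2 hu.le),
      Complex.ofReal_sub]
  have htend : Filter.Tendsto ((↑) : ℝ → ℂ) (nhdsWithin (μ - 1) {μ - 1}ᶜ)
      (nhdsWithin ((μ - 1 : ℝ) : ℂ) {((μ - 1 : ℝ) : ℂ)}ᶜ) :=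
    Complex.continuous_ofReal.continuousAt.continuousWithinAt.tendsto_nhdsWithin
      fun x hx => by simpa only [mem_compl_iff, mem_singleton_iff, Complex.ofReal_inj] using hx
  refine htend.frequently (Filter.Eventually.frequently ?_)
  exact nhdsWithin_le_nhds ((eventually_lt_nhds (sub_one_lt μ)).mono hreal)

theorem IsTemperedStableSubordinator.charFun_eq {β μ : ℝ} (hμ : 0 < μ)
    (hD : IsTemperedStableSubordinator P β μ D) {t : ℝ≥0} (ht : 0 < t) (ξ : ℝ) :
    charFun (P.map (D t)) ξ =
      Complex.exp (t * ((μ : ℂ) ^ (β : ℂ) - ((μ : ℂ) - ξ * Complex.I) ^ (β : ℂ))) := by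
  rw [← complexMGF_id_mul_I, hD.complexMGF_eq hμ ht (by simpa using hμ)]

theorem IsDensityOf.integrable [IsProbabilityMeasure P] {g : ℝ → ℝ → ℝ} (hg : IsDensityOf P D g)
    (hD : IsSubordinator P D) {t : ℝ≥0} (ht : 0 < t) :
    IntegrableOn (fun x => g x t) (Ioi 0) := by
  have := Measure.isProbabilityMeasure_map (hD.aemeasurable t)
  by_contra h
  have h1 := hg.integral_map ht (fun _ => (1 : ℝ))
  simp only [smul_eq_mul, mul_one] at h1
  rw [integral_undef h] at h1
  simp at h1

theorem IsDensityOf.fourier_indicator {g : ℝ → ℝ → ℝ} (hg : IsDensityOf P D g)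
    {t : ℝ≥0} (ht : 0 < t) (v : ℝ) :
    𝓕 ((Ioi (0 : ℝ)).indicator fun x => (g x t : ℂ)) v =
      charFun (P.map (D t)) (-(2 * Real.pi * v)) := by
  rw [charFun_apply_real, hg.integral_map ht, Real.fourier_real_eq_integral_exp_smul,
    ← integral_indicator measurableSet_Ioi]
  congr 1
  ext x
  by_cases hx : x ∈ Ioi (0 : ℝ)
  · simp only [indicator_of_mem hx, smul_eq_mul, Complex.real_smul, mul_comm (g x t : ℂ)]
    push_cast
    congr 2
    ring
  · simp only [indicator_of_notMem hx, smul_zero]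

end Transform

/-! ### Size and decay of the symbol -/

section Symbol

/-- The point `(μ + 2πiv) ^ β`, for which `exp (-t (μ + 2πiv) ^ β)` is the Laplace transform of
the `β`-stable density on the vertical line through `μ`. -/
noncomputable def lineCpow (β μ v : ℝ) : ℂ := ((μ : ℂ) + 2 * Real.pi * v * Complex.I) ^ (β : ℂ)

/-- The characteristic exponent of the tempered stable subordinator at frequency `-v`. -/
noncomputable def temperedSymbol (β μ v : ℝ) : ℂ := (μ : ℂ) ^ (β : ℂ) - lineCpow β μ v

variable {β μ : ℝ}

theorem line_mem_slitPlane (hμ : 0 < μ) (v : ℝ) :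
    (μ : ℂ) + 2 * Real.pi * v * Complex.I ∈ Complex.slitPlane := by
  left; simpa using hμ

theorem continuous_lineCpow (hμ : 0 < μ) : Continuous (lineCpow β μ) := by
  unfold lineCpow
  rw [continuous_iff_continuousAt]
  intro v
  exact ContinuousAt.cpow (by fun_prop) continuousAt_const (line_mem_slitPlane hμ v)

@[fun_prop]
theorem continuous_temperedSymbol (hμ : 0 < μ) : Continuous (temperedSymbol β μ) :=
  continuous_const.sub (continuous_lineCpow hμ)

theorem norm_line_sq (v : ℝ) :
    ‖(μ : ℂ) + 2 * Real.pi * v * Complex.I‖ ^ 2 = μ ^ 2 + (2 * Real.pi * v) ^ 2 := by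
  rw [Complex.sq_norm, Complex.normSq_apply]
  simp
  ring

theorem norm_line_pos (hμ : 0 < μ) (v : ℝ) :
    0 < ‖(μ : ℂ) + 2 * Real.pi * v * Complex.I‖ :=
  norm_pos_iff.2 (Complex.slitPlane_ne_zero (line_mem_slitPlane hμ v))

theorem norm_lineCpow (v : ℝ) :
    ‖lineCpow β μ v‖ = ‖(μ : ℂ) + 2 * Real.pi * v * Complex.I‖ ^ β :=
  Complex.norm_cpow_real _ _

theorem lineCpow_pow {m : ℕ} (hm : m ≠ 0) (v : ℝ) :
    lineCpow (1 / m) μ v ^ m = (μ : ℂ) + 2 * Real.pi * v * Complex.I := by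
  unfold lineCpow
  rw [← Complex.cpow_nat_mul]
  push_cast
  rw [mul_one_div_cancel (by exact_mod_cast hm), Complex.cpow_one]

/-- The base lies in the right half-plane, so its argument is at most `π/2` in absolute value; the
power `β ≤ 1/2` brings it within `π/4`. -/
theorem le_re_lineCpow (hμ : 0 < μ) (h0 : 0 ≤ β) (h1 : β ≤ 1 / 2) (v : ℝ) :
    Real.cos (Real.pi / 4) * ‖lineCpow β μ v‖ ≤ (lineCpow β μ v).re := by
  set z : ℂ := (μ : ℂ) + 2 * Real.pi * v * Complex.I with hz
  have harg : |z.arg| ≤ Real.pi / 2 :=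
    (Complex.abs_arg_le_pi_div_two_iff).2 (by simpa [hz] using hμ.le)
  have hre : (lineCpow β μ v).re = ‖z‖ ^ β * Real.cos (z.arg * β) := by
    unfold lineCpow
    rw [← hz, Complex.cpow_ofReal]
    rw [Complex.re_ofReal_mul]
    simp only [Complex.add_re, Complex.ofReal_re, Complex.re_ofReal_mul, Complex.I_re, mul_zero,
      add_zero]
  rw [hre, norm_lineCpow, mul_comm]
  refine mul_le_mul_of_nonneg_left ?_ (by positivity)
  rw [← Real.cos_abs (z.arg * β)]
  have : |z.arg * β| ≤ Real.pi / 4 := by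
    rw [abs_mul, abs_of_nonneg h0]
    nlinarith [abs_nonneg z.arg, Real.pi_pos]
  exact Real.cos_le_cos_of_nonneg_of_le_pi (abs_nonneg _) (by linarith [Real.pi_pos]) this

theorem cpow_le_norm_lineCpow (hμ : 0 < μ) (h0 : 0 ≤ β) (v : ℝ) :
    μ ^ β ≤ ‖lineCpow β μ v‖ := by
  rw [norm_lineCpow]
  refine Real.rpow_le_rpow hμ.le ?_ h0
  have := Complex.re_le_norm ((μ : ℂ) + 2 * Real.pi * v * Complex.I)
  simpa using this

theorem norm_temperedSymbol_le (hμ : 0 < μ) (h0 : 0 ≤ β) (v : ℝ) :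
    ‖temperedSymbol β μ v‖ ≤ 2 * ‖lineCpow β μ v‖ := by
  refine (norm_sub_le _ _).trans ?_
  rw [Complex.norm_cpow_real, Complex.norm_of_nonneg hμ.le, two_mul]
  gcongr
  exact cpow_le_norm_lineCpow hμ h0 v

theorem norm_exp_temperedSymbol_le (hμ : 0 < μ) (h0 : 0 ≤ β) (h1 : β ≤ 1 / 2) {a b t : ℝ}
    (ha : 0 ≤ a) (hat : a ≤ t) (htb : t ≤ b) (v : ℝ) :
    ‖Complex.exp (t * temperedSymbol β μ v)‖ ≤
      Real.exp (b * μ ^ β) * Real.exp (-(a * Real.cos (Real.pi / 4)) * ‖lineCpow β μ v‖) := by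
  rw [Complex.norm_exp, ← Real.exp_add, Real.exp_le_exp, Complex.re_ofReal_mul, temperedSymbol,
    Complex.sub_re, ← Complex.ofReal_cpow hμ.le, Complex.ofReal_re]
  have h2 := le_re_lineCpow hμ h0 h1 v
  have h3 : 0 ≤ Real.cos (Real.pi / 4) * ‖lineCpow β μ v‖ :=
    mul_nonneg (Real.cos_nonneg_of_mem_Icc ⟨by linarith [Real.pi_pos], by linarith [Real.pi_pos]⟩)
      (norm_nonneg _)
  have h4 : 0 ≤ μ ^ β := by positivity
  nlinarith [mul_le_mul_of_nonneg_right htb h4, mul_le_mul hat h2 h3 (ha.trans hat)]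

theorem integrable_norm_line_inv_sq (hμ : 0 < μ) :
    Integrable fun v : ℝ => (‖(μ : ℂ) + 2 * Real.pi * v * Complex.I‖ ^ 2)⁻¹ := by
  have h := (integrable_inv_one_add_sq.comp_mul_left' (R := 2 * Real.pi / μ)
    (by positivity)).const_mul (μ ^ 2)⁻¹
  refine h.congr (Filter.Eventually.of_forall fun v => ?_)
  simp only [norm_line_sq]
  rw [← mul_inv]
  congr 1
  field_simp

theorem integrable_pow_mul_exp_lineCpow {m : ℕ} (hm : m ≠ 0) (hμ : 0 < μ) {a : ℝ} (ha : 0 < a)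
    (N : ℕ) :
    Integrable fun v : ℝ =>
      ‖lineCpow (1 / m) μ v‖ ^ N * Real.exp (-a * ‖lineCpow (1 / m) μ v‖) := by
  have hk := (integrable_norm_line_inv_sq hμ).const_mul ((N + 2 * m).factorial / a ^ (N + 2 * m))
  refine hk.mono' ?_ (Filter.Eventually.of_forall fun v => ?_)
  · have := continuous_lineCpow (β := 1 / m) hμ
    exact Continuous.aestronglyMeasurable (by fun_prop)
  · have hm' := congrArg norm (lineCpow_pow (μ := μ) hm v)
    rw [norm_pow] at hm'
    rw [← hm']
    set w := ‖lineCpow (1 / m) μ v‖ with hw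
    have hw0 : 0 < w := by
      rw [hw, norm_lineCpow]
      exact Real.rpow_pos_of_pos (norm_line_pos hμ v) _
    rw [Real.norm_of_nonneg (by positivity)]
    -- In the exponent `N + 2m`, the `N` absorbs `w ^ N` and the `2m` leaves `w ^ (-2m) = ‖μ +
    -- 2πiv‖⁻²`, which is integrable.
    have h := Real.pow_div_factorial_le_exp (a * w) (by positivity) (N + 2 * m)
    rw [neg_mul, Real.exp_neg, ← pow_mul, ← div_eq_mul_inv, ← div_eq_mul_inv, div_div,
      div_le_div_iff₀ (Real.exp_pos _) (by positivity)]
    rw [div_le_iff₀ (by positivity)] at h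
    calc w ^ N * (a ^ (N + 2 * m) * w ^ (m * 2)) = (a * w) ^ (N + 2 * m) := by ring
      _ ≤ Real.exp (a * w) * (N + 2 * m).factorial := h
      _ = _ := mul_comm _ _

end Symbol

/-! ### Differentiating the Fourier integral -/

section InverseTransform

/-- Continuous amplitudes bounded by a power of `‖(μ + 2πiv) ^ β‖`. -/
def IsTemperedAmplitude (β μ : ℝ) (p : ℝ → ℂ) : Prop :=
  Continuous p ∧ ∃ (C : ℝ) (N : ℕ), 0 ≤ C ∧ ∀ v, ‖p v‖ ≤ C * ‖lineCpow β μ v‖ ^ N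

/-- The Fourier integral with amplitude `p` and phase `exp (2πivx + t ψ(v))`, where `ψ` is the
symbol of the tempered stable subordinator. -/
noncomputable def symbolIntegral (β μ : ℝ) (p : ℝ → ℂ) (x t : ℝ) : ℂ :=
  ∫ v : ℝ, p v * (Complex.exp (2 * Real.pi * v * x * Complex.I) *
    Complex.exp (t * temperedSymbol β μ v))

variable {β μ : ℝ} {p q : ℝ → ℂ}

theorem IsTemperedAmplitude.mul (hp : IsTemperedAmplitude β μ p) (hq : IsTemperedAmplitude β μ q) :
    IsTemperedAmplitude β μ fun v => p v * q v := by
  obtain ⟨hpc, C, N, hC, hpb⟩ := hp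
  obtain ⟨hqc, C', N', hC', hqb⟩ := hq
  refine ⟨hpc.mul hqc, C * C', N + N', mul_nonneg hC hC', fun v => ?_⟩
  rw [norm_mul, pow_add, mul_mul_mul_comm]
  exact mul_le_mul (hpb v) (hqb v) (norm_nonneg _) (by positivity)

theorem isTemperedAmplitude_const (c : ℂ) : IsTemperedAmplitude β μ fun _ => c :=
  ⟨continuous_const, ‖c‖, 0, norm_nonneg _, fun v => by simp⟩

theorem isTemperedAmplitude_temperedSymbol (hμ : 0 < μ) (h0 : 0 ≤ β) :
    IsTemperedAmplitude β μ (temperedSymbol β μ) :=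
  ⟨continuous_temperedSymbol hμ, 2, 1, by norm_num, fun v => by
    simpa using norm_temperedSymbol_le hμ h0 v⟩

theorem isTemperedAmplitude_temperedSymbol_pow (hμ : 0 < μ) (h0 : 0 ≤ β) (k : ℕ) :
    IsTemperedAmplitude β μ fun v => temperedSymbol β μ v ^ k := by
  induction k with
  | zero => simpa using isTemperedAmplitude_const 1
  | succ k ih => simpa only [pow_succ] using ih.mul (isTemperedAmplitude_temperedSymbol hμ h0)

theorem isTemperedAmplitude_frequency {m : ℕ} (hm : m ≠ 0) :
    IsTemperedAmplitude (1 / m) μ fun v => 2 * Real.pi * v * Complex.I := by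
  refine ⟨by fun_prop, 1, m, zero_le_one, fun v => ?_⟩
  rw [one_mul, ← norm_pow, lineCpow_pow hm, ← sq_le_sq₀ (norm_nonneg _) (norm_nonneg _),
    norm_line_sq]
  have : ‖(2 * Real.pi * v * Complex.I : ℂ)‖ ^ 2 = (2 * Real.pi * v) ^ 2 := by
    rw [Complex.sq_norm, Complex.normSq_apply]
    simp
    ring
  rw [this]
  nlinarith [sq_nonneg μ]

theorem norm_exp_two_pi_mul_I (v x : ℝ) :
    ‖Complex.exp (2 * Real.pi * v * x * Complex.I)‖ = 1 := by
  have := Complex.norm_exp_ofReal_mul_I (2 * Real.pi * v * x)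
  push_cast at this
  exact this

/-- On compact ranges of `t`, the integrand of `symbolIntegral` has an integrable majorant. -/
theorem IsTemperedAmplitude.exists_bound {m : ℕ} (hm : 2 ≤ m) (hμ : 0 < μ)
    (hp : IsTemperedAmplitude (1 / m) μ p) {a : ℝ} (ha : 0 < a) (b : ℝ) :
    ∃ bound : ℝ → ℝ, Integrable bound ∧ ∀ t, a ≤ t → t ≤ b → ∀ x v : ℝ,
      ‖p v * (Complex.exp (2 * Real.pi * v * x * Complex.I) *
        Complex.exp (t * temperedSymbol (1 / m) μ v))‖ ≤ bound v := by
  obtain ⟨hpc, C, N, hC, hpb⟩ := hp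
  have hc : 0 < Real.cos (Real.pi / 4) :=
    Real.cos_pos_of_mem_Ioo ⟨by linarith [Real.pi_pos], by linarith [Real.pi_pos]⟩
  have h1 : (1 / m : ℝ) ≤ 1 / 2 := by
    have : (2 : ℝ) ≤ m := by exact_mod_cast hm
    gcongr
  refine ⟨_, (integrable_pow_mul_exp_lineCpow (m := m) (by lia) hμ (mul_pos ha hc) N).const_mul
    (C * Real.exp (b * μ ^ (1 / m : ℝ))), fun t hat htb x v => ?_⟩
  rw [norm_mul, norm_mul, norm_exp_two_pi_mul_I, one_mul]
  refine (mul_le_mul (hpb v) (norm_exp_temperedSymbol_le hμ (by positivity) h1 ha.le hat htb v)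
    (norm_nonneg _) (by positivity)).trans (le_of_eq ?_)
  ring

theorem IsTemperedAmplitude.aestronglyMeasurable (hμ : 0 < μ) (hp : IsTemperedAmplitude β μ p)
    (x t : ℝ) :
    AEStronglyMeasurable (fun v : ℝ => p v * (Complex.exp (2 * Real.pi * v * x * Complex.I) *
      Complex.exp (t * temperedSymbol β μ v))) := by
  have h1 := hp.1
  have h2 := continuous_temperedSymbol (β := β) hμ
  exact Continuous.aestronglyMeasurable (by fun_prop)

theorem IsTemperedAmplitude.integrable {m : ℕ} (hm : 2 ≤ m) (hμ : 0 < μ)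
    (hp : IsTemperedAmplitude (1 / m) μ p) (x : ℝ) {t : ℝ} (ht : 0 < t) :
    Integrable fun v : ℝ => p v * (Complex.exp (2 * Real.pi * v * x * Complex.I) *
      Complex.exp (t * temperedSymbol (1 / m) μ v)) := by
  obtain ⟨bound, hb, h⟩ := hp.exists_bound hm hμ ht t
  exact hb.mono' (hp.aestronglyMeasurable hμ x t)
    (Filter.Eventually.of_forall fun v => h t le_rfl le_rfl x v)

theorem IsTemperedAmplitude.hasDerivAt_time {m : ℕ} (hm : 2 ≤ m) (hμ : 0 < μ)
    (hp : IsTemperedAmplitude (1 / m) μ p) (x : ℝ) {t : ℝ} (ht : 0 < t) :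
    HasDerivAt (symbolIntegral (1 / m) μ p x)
      (symbolIntegral (1 / m) μ (fun v => p v * temperedSymbol (1 / m) μ v) x t) t := by
  have hp' := hp.mul (isTemperedAmplitude_temperedSymbol hμ (by positivity))
  -- The majorant needs times bounded away from `0`, where the decay is lost; `[t/2, 2t]` is such a
  -- neighbourhood of `t`.
  obtain ⟨bound, hb, h⟩ := hp'.exists_bound hm hμ (half_pos ht) (2 * t)
  refine (hasDerivAt_integral_of_dominated_loc_of_deriv_le (s := Icc (t / 2) (2 * t))
    (Icc_mem_nhds (by linarith) (by linarith))
    (Filter.Eventually.of_forall fun τ => hp.aestronglyMeasurable hμ x τ)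
    (hp.integrable hm hμ x ht) (hp'.aestronglyMeasurable hμ x t)
    (Filter.Eventually.of_forall fun v τ hτ => h τ hτ.1 hτ.2 x v) hb
    (Filter.Eventually.of_forall fun v τ _ => ?_)).2
  have h1 : HasDerivAt (fun τ : ℝ => (τ : ℂ) * temperedSymbol (1 / m) μ v)
      (temperedSymbol (1 / m) μ v) τ := by
    simpa using (Complex.ofRealCLM.hasDerivAt (x := τ)).mul_const (temperedSymbol (1 / m) μ v)
  convert! (h1.cexp.const_mul (Complex.exp (2 * Real.pi * v * x * Complex.I))).const_mul (p v)
    using 1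
  ring

theorem IsTemperedAmplitude.hasDerivAt_space {m : ℕ} (hm : 2 ≤ m) (hμ : 0 < μ)
    (hp : IsTemperedAmplitude (1 / m) μ p) (x : ℝ) {t : ℝ} (ht : 0 < t) :
    HasDerivAt (fun y => symbolIntegral (1 / m) μ p y t)
      (symbolIntegral (1 / m) μ (fun v => p v * (2 * Real.pi * v * Complex.I)) x t) x := by
  have hp' := hp.mul (isTemperedAmplitude_frequency (m := m) (by lia))
  obtain ⟨bound, hb, h⟩ := hp'.exists_bound hm hμ ht t
  refine (hasDerivAt_integral_of_dominated_loc_of_deriv_le (s := univ) Filter.univ_mem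
    (Filter.Eventually.of_forall fun y => hp.aestronglyMeasurable hμ y t)
    (hp.integrable hm hμ x ht) (hp'.aestronglyMeasurable hμ x t)
    (Filter.Eventually.of_forall fun v y _ => h t le_rfl le_rfl y v) hb
    (Filter.Eventually.of_forall fun v y _ => ?_)).2
  have h1 : HasDerivAt (fun y : ℝ => 2 * Real.pi * v * (y : ℂ) * Complex.I)
      (2 * Real.pi * v * Complex.I) y := by
    simpa using ((Complex.ofRealCLM.hasDerivAt (x := y)).const_mul
      (2 * Real.pi * v : ℂ)).mul_const Complex.I
  convert! (h1.cexp.mul_const (Complex.exp (t * temperedSymbol (1 / m) μ v))).const_mul (p v)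
    using 1
  ring

/-- The binomial theorem for `(μ + 2πiv) ^ (1 / m) = μ ^ (1 / m) - ψ(v)`. -/
theorem sum_choose_mul_temperedSymbol_pow {m : ℕ} (hm : m ≠ 0) (hμ : 0 < μ) (v : ℝ) :
    ∑ j ∈ Finset.Icc 1 m,
      (((-1 : ℝ) ^ j * (m.choose j : ℝ) * μ ^ (1 - (j : ℝ) / (m : ℝ)) : ℝ) : ℂ) *
        temperedSymbol (1 / m) μ v ^ j = 2 * Real.pi * v * Complex.I := by
  have hm' : (m : ℝ) ≠ 0 := by exact_mod_cast hm
  set b : ℝ := μ ^ (1 / m : ℝ) with hb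
  have hbm : b ^ m = μ := by
    rw [hb, ← Real.rpow_mul_natCast hμ.le, one_div_mul_cancel hm', Real.rpow_one]
  have hpow : ∀ j ≤ m, μ ^ (1 - (j : ℝ) / (m : ℝ)) = b ^ (m - j) := by
    intro j hj
    rw [hb, ← Real.rpow_mul_natCast hμ.le]
    congr 1
    push_cast [hj]
    field_simp
  have hsym : -temperedSymbol (1 / m) μ v + b = lineCpow (1 / m) μ v := by
    rw [temperedSymbol, ← Complex.ofReal_cpow hμ.le]
    ring
  have h := lineCpow_pow (μ := μ) hm v
  -- The `j = 0` term is split off: it equals `μ` and cancels against the right-hand side.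
  rw [← hsym, add_pow, Finset.range_eq_Ico, Finset.sum_eq_sum_Ico_succ_bot (by lia)] at h
  simp only [pow_zero, one_mul, Nat.sub_zero, Nat.choose_zero_right, Nat.cast_one, mul_one] at h
  rw [← Complex.ofReal_pow, hbm, add_right_inj] at h
  rw [← h]
  refine Finset.sum_congr (by ext; simp) fun j hj => ?_
  rw [hpow j (by simp at hj; lia), neg_pow]
  push_cast
  ring

theorem IsTemperedAmplitude.symbolIntegral_sum {m : ℕ} (hm : 2 ≤ m) (hμ : 0 < μ) {ι : Type*}
    (s : Finset ι) {p : ι → ℝ → ℂ} (hp : ∀ i, IsTemperedAmplitude (1 / m) μ (p i)) (c : ι → ℂ)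
    (x : ℝ) {t : ℝ} (ht : 0 < t) :
    ∑ i ∈ s, c i * symbolIntegral (1 / m) μ (p i) x t =
      symbolIntegral (1 / m) μ (fun v => ∑ i ∈ s, c i * p i v) x t := by
  simp only [symbolIntegral, ← integral_const_mul]
  rw [← integral_finsetSum _ fun i _ => ((hp i).integrable hm hμ x ht).const_mul _]
  simp only [Finset.sum_mul, mul_assoc]

end InverseTransform

/-! ### Chains of successive derivatives on an open set -/

section IteratedDeriv

variable {E : Type*} [NormedAddCommGroup E] [NormedSpace ℝ E] {s : Set ℝ} {G : ℕ → ℝ → E}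

theorem iteratedDeriv_eq_of_hasDerivAt (hs : IsOpen s)
    (hG : ∀ k, ∀ t ∈ s, HasDerivAt (G k) (G (k + 1) t) t) (k : ℕ) {t : ℝ} (ht : t ∈ s) :
    iteratedDeriv k (G 0) t = G k t := by
  induction k generalizing t with
  | zero => simp
  | succ k ih =>
    rw [iteratedDeriv_succ, Filter.EventuallyEq.deriv_eq (f := G k), (hG k t ht).deriv]
    filter_upwards [hs.mem_nhds ht] with τ hτ using ih hτ

theorem contDiffOn_of_hasDerivAt (hs : IsOpen s)
    (hG : ∀ k, ∀ t ∈ s, HasDerivAt (G k) (G (k + 1) t) t) (n k : ℕ) :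
    ContDiffOn ℝ n (G k) s := by
  induction n generalizing k with
  | zero => exact contDiffOn_zero.2 fun t ht => (hG k t ht).continuousAt.continuousWithinAt
  | succ n ih =>
    push_cast
    rw [contDiffOn_succ_iff_deriv_of_isOpen hs]
    refine ⟨fun t ht => (hG k t ht).differentiableAt.differentiableWithinAt, by simp, ?_⟩
    exact (ih (k + 1)).congr fun t ht => (hG k t ht).deriv

end IteratedDeriv

/-- Fourier inversion for the density of a tempered stable subordinator. -/
theorem IsDensityOf.eq_symbolIntegral {Ω : Type*} [MeasurableSpace Ω] {P : Measure Ω}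
    [IsProbabilityMeasure P] {D : ℝ≥0 → Ω → ℝ} {m : ℕ} (hm : 2 ≤ m) {μ : ℝ} (hμ : 0 < μ)
    (hD : IsTemperedStableSubordinator P (1 / (m : ℝ)) μ D) {g : ℝ → ℝ → ℝ}
    (hg : IsDensityOf P D g) {x t : ℝ} (hx : 0 < x) (ht : 0 < t) :
    (g x t : ℂ) = symbolIntegral (1 / m) μ (fun _ => 1) x t := by
  lift t to ℝ≥0 using ht.le
  have ht' : 0 < t := by exact_mod_cast ht
  have hF : 𝓕 ((Ioi (0 : ℝ)).indicator fun x => (g x t : ℂ)) =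
      fun v => Complex.exp (t * temperedSymbol (1 / m) μ v) := by
    ext v
    rw [hg.fourier_indicator ht', hD.charFun_eq hμ ht', temperedSymbol, lineCpow]
    push_cast
    congr 5
    ring
  have hint : Integrable ((Ioi (0 : ℝ)).indicator fun x => (g x t : ℂ)) :=
    (integrable_indicator_iff measurableSet_Ioi).2 (hg.integrable hD.isSubordinator ht').ofReal
  have hintF : Integrable (𝓕 ((Ioi (0 : ℝ)).indicator fun x => (g x t : ℂ))) := by
    rw [hF]
    -- At `x = 0` the oscillating factor is `1`, leaving `exp (t ψ)` alone.
    simpa using (isTemperedAmplitude_const (β := 1 / m) (μ := μ) 1).integrable hm hμ 0 ht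
  have hcont : ContinuousAt ((Ioi (0 : ℝ)).indicator fun x => (g x t : ℂ)) x := by
    have h1 : ContinuousAt (fun x => (g x t : ℂ)) x :=
      Complex.continuous_ofReal.continuousAt.comp
        ((hg.continuousOn t ht').continuousAt (Ioi_mem_nhds hx))
    refine h1.congr ?_
    filter_upwards [Ioi_mem_nhds hx] with y hy
    rw [indicator_of_mem hy]
  have hinv := hint.fourierInv_fourier_eq hintF hcont
  rw [indicator_of_mem (mem_Ioi.2 hx), Real.fourierInv_eq', hF] at hinv
  rw [← hinv, symbolIntegral]
  congr 1
  ext v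
  simp only [smul_eq_mul, one_mul, RCLike.inner_apply, conj_trivial]
  congr 2
  push_cast
  ring

theorem proposition4p1 {Ω : Type*} [MeasurableSpace Ω] (P : Measure Ω) [IsProbabilityMeasure P]
    (m : ℕ) (hm : 2 ≤ m) (μ : ℝ) (hμ : 0 < μ) (D : ℝ≥0 → Ω → ℝ)
    (hD : IsTemperedStableSubordinator P (1 / (m : ℝ)) μ D)
    (fμ : ℝ → ℝ → ℝ) (hf : IsDensityOf P D fμ) (x t : ℝ) (hx : 0 < x) (ht : 0 < t) :
    ContDiffAt ℝ (m : ℕ) (fun τ => fμ x τ) t ∧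
    DifferentiableAt ℝ (fun y => fμ y t) x ∧
    ∑ j ∈ Finset.Icc 1 m,
        (-1 : ℝ) ^ j * (m.choose j : ℝ) * μ ^ (1 - (j : ℝ) / (m : ℝ)) *
          iteratedDeriv j (fun τ => fμ x τ) t =
      deriv (fun y => fμ y t) x := by
  have hβ : (0 : ℝ) ≤ 1 / m := by positivity
  have hamp := isTemperedAmplitude_temperedSymbol_pow (β := 1 / m) hμ hβ
  set G : ℕ → ℝ → ℝ := fun k τ =>
    (symbolIntegral (1 / m) μ (fun v => temperedSymbol (1 / m) μ v ^ k) x τ).re with hGdef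
  have hG : ∀ k, ∀ τ ∈ Ioi (0 : ℝ), HasDerivAt (G k) (G (k + 1) τ) τ := fun k τ hτ =>
    Complex.reCLM.hasFDerivAt.comp_hasDerivAt τ ((hamp k).hasDerivAt_time hm hμ x hτ)
  have heq : ∀ y > 0, ∀ τ > 0, fμ y τ = (symbolIntegral (1 / m) μ (fun _ => 1) y τ).re :=
    fun y hy τ hτ => by rw [← hf.eq_symbolIntegral hm hμ hD hy hτ, Complex.ofReal_re]
  have htime : (fun τ => fμ x τ) =ᶠ[nhds t] G 0 := by
    filter_upwards [Ioi_mem_nhds ht] with τ hτ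
    simpa [hGdef] using heq x hx τ hτ
  have hspace : HasDerivAt (fun y => fμ y t)
      (symbolIntegral (1 / m) μ (fun v => 1 * (2 * Real.pi * v * Complex.I)) x t).re x := by
    have h : HasDerivAt (fun y => (symbolIntegral (1 / m) μ (fun _ => 1) y t).re) _ x :=
      Complex.reCLM.hasFDerivAt.comp_hasDerivAt x
        ((isTemperedAmplitude_const 1).hasDerivAt_space hm hμ x ht)
    refine h.congr_of_eventuallyEq ?_
    filter_upwards [Ioi_mem_nhds hx] with y hy using heq y hy t ht
  refine ⟨?_, hspace.differentiableAt, ?_⟩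
  · exact ((contDiffOn_of_hasDerivAt isOpen_Ioi hG m 0).contDiffAt
      (Ioi_mem_nhds ht)).congr_of_eventuallyEq htime
  · rw [hspace.deriv]
    -- The factor `2πiv` from the space derivative is replaced by the polynomial in `ψ`, whose
    -- powers are the time derivatives.
    simp only [one_mul, ← sum_choose_mul_temperedSymbol_pow (m := m) (by lia) hμ]
    rw [← IsTemperedAmplitude.symbolIntegral_sum hm hμ _ hamp _ x ht, Complex.re_sum]
    refine Finset.sum_congr rfl fun j _ => ?_
    rw [htime.iteratedDeriv_eq, iteratedDeriv_eq_of_hasDerivAt isOpen_Ioi hG j ht,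
      Complex.re_ofReal_mul]
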